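/- Let $A=(a_{i,j})\in\mathbb R^{n\times n}$ be a nonsingular M-matrix, i.e. $a_{i,j}\le 0$ for all $i\ne j$ (that is, $A$ is a Z-matrix), $A$ is invertible, and $A^{-1}$ is entrywise nonnegative with at least one positive entry. Let $Q_1=(q_{i,j})\in\mathbb R^{n\times n}$ satisfy $q_{i,i}=0$ for all $i$, $q_{i,j}\ge 0$ for all $i\neq j$, and $\sum_{i\ne j}q_{i,j}\ne 0$; put $P_1=I+Q_1$. For $B\in\mathbb R^{n\times n}$ write $B=D_B-L_B-U_B$ with $D_B$ diagonal, $L_B$ strictly lower triangular and $U_B$ strictly upper triangular, and, when $D_B-\gamma L_B$ is invertible, let $$\mathscr L_{\gamma,\omega}(B)=(D_B-\gamma L_B)^{-1}\left[(1-\omega)D_B+(\omega-\gamma)L_B+\omega U_B\right]$$ be the AOR iteration matrix of $B$. Put $\mathscr L_{\gamma,\omega}=\mathscr L_{\gamma,\omega}(A)$ and $\mathscr L^{(1)}_{\gamma,\omega}=\mathscr L_{\gamma,\omega}(P_1A)$, and let $\rho$ denote the spectral radius (the largest modulus of a complex eigenvalue). Suppose that $P_1A$ is a Z-matrix, i.e.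 its off-diagonal entries are nonpositive. Then for all real $\omega,\gamma$ with $0<\omega\le 1$ and $0\le\gamma\le 1$, both iteration matrices are well defined (the matrices $D_A-\gamma L_A$ and $D_{P_1A}-\gamma L_{P_1A}$ are invertible) and $$\rho(\mathscr L^{(1)}_{\gamma,\omega})\le\rho(\mathscr L_{\gamma,\omega})<1 .$$ -/

import Mathlib

namespace AOR

/-- Off-diagonal entries are nonpositive. -/
def IsZMatrix {n : ℕ} (B : Matrix (Fin n) (Fin n) ℝ) : Prop :=
  ∀ i j, i ≠ j → B i j ≤ 0

/-- All entries are nonnegative and at least one is positive. -/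
def IsSemipositive {n : ℕ} (B : Matrix (Fin n) (Fin n) ℝ) : Prop :=
  (∀ i j, 0 ≤ B i j) ∧ ∃ i j, 0 < B i j

/-- `B` is invertible and its inverse is semi-positive. -/
def IsMonotone {n : ℕ} (B : Matrix (Fin n) (Fin n) ℝ) : Prop :=
  IsUnit B ∧ IsSemipositive B⁻¹

/-- A nonsingular M-matrix is a monotone Z-matrix. -/
def IsNonsingularMMatrix {n : ℕ} (B : Matrix (Fin n) (Fin n) ℝ) : Prop :=
  IsZMatrix B ∧ IsMonotone B

/-- The diagonal matrix `D` of the decomposition `A = D - L - U`. -/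
def D {n : ℕ} (A : Matrix (Fin n) (Fin n) ℝ) : Matrix (Fin n) (Fin n) ℝ :=
  Matrix.of fun i j => if i = j then A i j else 0

/-- The strictly lower triangular matrix `L` of the decomposition `A = D - L - U`. -/
def L {n : ℕ} (A : Matrix (Fin n) (Fin n) ℝ) : Matrix (Fin n) (Fin n) ℝ :=
  Matrix.of fun i j => if j < i then -A i j else 0

/-- The strictly upper triangular matrix `U` of the decomposition `A = D - L - U`. -/
def U {n : ℕ} (A : Matrix (Fin n) (Fin n) ℝ) : Matrix (Fin n) (Fin n) ℝ :=
  Matrix.of fun i j => if i < j then -A i j else 0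

theorem eq_D_sub_L_sub_U {n : ℕ} (A : Matrix (Fin n) (Fin n) ℝ) : A = D A - L A - U A := by
  ext i j
  rcases lt_trichotomy i j with h | h | h
  · simp [D, L, U, h, h.ne, h.not_gt]
  · simp [D, L, U, h]
  · simp [D, L, U, h, h.ne', h.not_gt]

/-- The AOR iteration matrix of `A`,
`(D - γ L)⁻¹ [(1 - ω) D + (ω - γ) L + ω U]`; it is meaningful when `D - γ L` is invertible. -/
noncomputable def iterMatrix {n : ℕ} (γ ω : ℝ) (A : Matrix (Fin n) (Fin n) ℝ) :
    Matrix (Fin n) (Fin n) ℝ :=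
  (D A - γ • L A)⁻¹ * ((1 - ω) • D A + (ω - γ) • L A + ω • U A)

/-- The spectral radius of a real matrix: the largest modulus of its complex eigenvalues. -/
noncomputable def rho {n : ℕ} (B : Matrix (Fin n) (Fin n) ℝ) : ENNReal :=
  spectralRadius ℂ (B.map (algebraMap ℝ ℂ))

/-- The class of matrices `Q` in the preconditioners `P = I + Q`: zero diagonal, nonnegative
off-diagonal entries, and nonzero sum of the off-diagonal entries. -/
structure IsPrecondQ {n : ℕ} (Q : Matrix (Fin n) (Fin n) ℝ) : Prop where
  diag_eq_zero : ∀ i, Q i i = 0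
  offDiag_nonneg : ∀ i j, i ≠ j → 0 ≤ Q i j
  sum_offDiag_ne_zero : (∑ i, ∑ j ∈ Finset.univ.erase i, Q i j) ≠ 0

end AOR

/-! Write `M = D - γ L`, so that the AOR matrix of `B` is `1 - ω M⁻¹ B`. With `M'` the splitting
matrix of `P A` and `C = M'⁻¹ P`, the preconditioned matrix is `1 - ω C A`, so both iterations
concern the same `A`. `M' ≤ (1 - L Q) M` and `1 - L Q ≤ P` give `M⁻¹ ≤ C` (`splitM_precond_le`,
`inv_le_inv_mul`). For `c < 1` above the old radius, some `x > 0` has `A x ≥ 0` and `ω M⁻¹ A x ≥ (1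
- c) x`. Replacing `M⁻¹` by the larger `C` preserves this, so the new radius is at most `c`
(`rho_le_rho_of_inv_le`). Positive test vectors replace Perron–Frobenius theory, so irreducibility
is not needed. -/

/-! ### Z-matrices and positive vectors -/

open Matrix in
theorem AOR.nonneg_of_mulVec_nonneg {n : ℕ} {B : Matrix (Fin n) (Fin n) ℝ}
    (hB : AOR.IsZMatrix B) {x : Fin n → ℝ} (hx : ∀ i, 0 < x i) (hBx : ∀ i, 0 < (B *ᵥ x) i)
    {y : Fin n → ℝ} (hy : ∀ i, 0 ≤ (B *ᵥ y) i) (i : Fin n) : 0 ≤ y i := by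
  by_contra! hi
  -- With `t < 0` the minimal ratio, `y - t x` is nonnegative and vanishes at `k`; the signs of row
  -- `k` then give `(B y) k ≤ t (B x) k < 0`.
  obtain ⟨k, -, hk⟩ := Finset.exists_min_image Finset.univ (fun j => y j / x j)
    ⟨i, Finset.mem_univ i⟩
  set t := y k / x k with ht
  have htneg : t < 0 := (hk i (Finset.mem_univ i)).trans_lt (div_neg_of_neg_of_pos hi (hx i))
  have hle : ∀ j, t * x j ≤ y j := fun j => (le_div_iff₀ (hx j)).1 (hk j (Finset.mem_univ j))
  have hkk : t * x k = y k := div_mul_cancel₀ _ (hx k).ne'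
  have h1 : (B *ᵥ y) k ≤ t * (B *ᵥ x) k := by
    simp only [mulVec, dotProduct, Finset.mul_sum]
    refine Finset.sum_le_sum fun j _ => ?_
    rcases eq_or_ne k j with rfl | hkj
    · rw [← hkk]; exact le_of_eq (by ring)
    · nlinarith [mul_le_mul_of_nonpos_left (hle j) (hB k j hkj)]
  exact absurd (hy k) (not_le.2 (h1.trans_lt (mul_neg_of_neg_of_pos htneg (hBx k))))

open Matrix in
/-- A Z-matrix which maps some positive vector to a positive vector is invertible, with
nonnegative inverse. -/
theorem AOR.isUnit_and_inv_nonneg {n : ℕ} {B : Matrix (Fin n) (Fin n) ℝ}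
    (hB : AOR.IsZMatrix B) {x : Fin n → ℝ} (hx : ∀ i, 0 < x i) (hBx : ∀ i, 0 < (B *ᵥ x) i) :
    IsUnit B ∧ ∀ i j, 0 ≤ B⁻¹ i j := by
  have hu : IsUnit B := by
    rw [← mulVec_injective_iff_isUnit]
    intro u v huv
    have h0 : B *ᵥ (u - v) = 0 := by rw [mulVec_sub, sub_eq_zero]; exact huv
    have h0' : B *ᵥ (v - u) = 0 := by rw [mulVec_sub, sub_eq_zero]; exact huv.symm
    funext i
    have h1 := AOR.nonneg_of_mulVec_nonneg hB hx hBx (y := u - v) (by simp [h0]) i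
    have h2 := AOR.nonneg_of_mulVec_nonneg hB hx hBx (y := v - u) (by simp [h0']) i
    simp only [Pi.sub_apply] at h1 h2
    linarith
  refine ⟨hu, fun i j => ?_⟩
  have h := AOR.nonneg_of_mulVec_nonneg hB hx hBx (y := B⁻¹ *ᵥ Pi.single j 1) (fun k => by
    rw [mulVec_mulVec, mul_nonsing_inv _ ((isUnit_iff_isUnit_det _).1 hu), one_mulVec]
    exact (Pi.single_nonneg.2 (zero_le_one (α := ℝ)) : (0 : Fin n → ℝ) ≤ Pi.single j 1) k) i
  simpa using h

open Matrix in
theorem AOR.mulVec_nonneg {n : ℕ} {C : Matrix (Fin n) (Fin n) ℝ} (hC : ∀ i j, 0 ≤ C i j)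
    {v : Fin n → ℝ} (hv : ∀ i, 0 ≤ v i) (i : Fin n) : 0 ≤ (C *ᵥ v) i := by
  rw [mulVec, dotProduct]
  exact Finset.sum_nonneg fun j _ => mul_nonneg (hC i j) (hv j)

theorem AOR.mul_nonneg {n : ℕ} {B C : Matrix (Fin n) (Fin n) ℝ} (hB : ∀ i j, 0 ≤ B i j)
    (hC : ∀ i j, 0 ≤ C i j) (i j : Fin n) : 0 ≤ (B * C) i j := by
  rw [Matrix.mul_apply]
  exact Finset.sum_nonneg fun k _ => _root_.mul_nonneg (hB i k) (hC k j)

-- A zero entry of the product would force a zero row of `C`.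
open Matrix in
theorem AOR.mulVec_pos {n : ℕ} {C : Matrix (Fin n) (Fin n) ℝ} (hu : IsUnit C)
    (hC : ∀ i j, 0 ≤ C i j) {v : Fin n → ℝ} (hv : ∀ i, 0 < v i) (i : Fin n) :
    0 < (C *ᵥ v) i := by
  refine (AOR.mulVec_nonneg hC (fun j => (hv j).le) i).lt_of_ne' fun h => ?_
  rw [mulVec, dotProduct] at h
  have hrow : ∀ j, C i j = 0 := fun j => by
    have := (Finset.sum_eq_zero_iff_of_nonneg
      (fun k _ => _root_.mul_nonneg (hC i k) (hv k).le)).1 h j (Finset.mem_univ j)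
    exact (mul_eq_zero.1 this).resolve_right (hv j).ne'
  have h1 : (C * C⁻¹) i i = 0 := by simp [mul_apply, hrow]
  rw [mul_nonsing_inv _ ((isUnit_iff_isUnit_det _).1 hu)] at h1
  simp at h1

/-! ### Spectral radius and positive test vectors -/

open Matrix in
/-- A positive vector `z` with `T z ≤ c z` bounds the spectral radius of a nonnegative matrix. -/
theorem AOR.rho_le_of_mulVec_le {n : ℕ} {T : Matrix (Fin n) (Fin n) ℝ} (hT : ∀ i j, 0 ≤ T i j)
    {z : Fin n → ℝ} (hz : ∀ i, 0 < z i) {c : ℝ} (h : ∀ i, (T *ᵥ z) i ≤ c * z i) :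
    AOR.rho T ≤ ENNReal.ofReal c := by
  refine iSup₂_le fun μ hμ => ?_
  rw [spectrum.mem_iff, isUnit_iff_isUnit_det, isUnit_iff_ne_zero, not_not,
    ← exists_mulVec_eq_zero_iff] at hμ
  obtain ⟨v, hv0, hv⟩ := hμ
  rw [sub_mulVec, sub_eq_zero, Algebra.algebraMap_eq_smul_one, smul_mulVec, one_mulVec] at hv
  obtain ⟨l, hl⟩ := Function.ne_iff.1 hv0
  -- The smallest multiple `t z` dominating `|v|` touches it at `k`; the eigenvalue equation is
  -- compared there.
  obtain ⟨k, -, hk⟩ := Finset.exists_max_image Finset.univ (fun j => ‖v j‖ / z j)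
    ⟨l, Finset.mem_univ l⟩
  set t := ‖v k‖ / z k with ht
  have htpos : 0 < t :=
    (div_pos (norm_pos_iff.2 hl) (hz l)).trans_le (hk l (Finset.mem_univ l))
  have hle : ∀ j, ‖v j‖ ≤ t * z j := fun j => (div_le_iff₀ (hz j)).1 (hk j (Finset.mem_univ j))
  have hkk : t * z k = ‖v k‖ := div_mul_cancel₀ _ (hz k).ne'
  have hmain : ‖μ‖ * ‖v k‖ ≤ c * ‖v k‖ := calc
    ‖μ‖ * ‖v k‖ = ‖(T.map (algebraMap ℝ ℂ) *ᵥ v) k‖ := by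
      rw [← hv, Pi.smul_apply, smul_eq_mul, norm_mul]
    _ ≤ ∑ j, T k j * ‖v j‖ := by
      rw [mulVec, dotProduct]
      refine (norm_sum_le _ _).trans (Finset.sum_le_sum fun j _ => ?_)
      simp [abs_of_nonneg (hT k j)]
    _ ≤ ∑ j, T k j * (t * z j) :=
      Finset.sum_le_sum fun j _ => mul_le_mul_of_nonneg_left (hle j) (hT k j)
    _ = t * (T *ᵥ z) k := by
      simp only [mulVec, dotProduct, Finset.mul_sum]
      exact Finset.sum_congr rfl fun j _ => by ring
    _ ≤ t * (c * z k) := mul_le_mul_of_nonneg_left (h k) htpos.le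
    _ = c * ‖v k‖ := by rw [← hkk]; ring
  have hvk : 0 < ‖v k‖ := hkk ▸ mul_pos htpos (hz k)
  have hμc : ‖μ‖ ≤ c := le_of_mul_le_mul_right hmain hvk
  rw [← enorm_eq_nnnorm, ← ofReal_norm]
  exact ENNReal.ofReal_le_ofReal hμc

-- Gelfand's formula in the `ℓ∞` operator norm, where the all-ones vector has norm at most one.
open Matrix in
attribute [local instance] Matrix.linftyOpNormedRing Matrix.linftyOpNormedAlgebra in
theorem AOR.exists_pow_mulVec_one_lt {n : ℕ} {S : Matrix (Fin n) (Fin n) ℝ} {c : ℝ}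
    (h : AOR.rho S < ENNReal.ofReal c) : ∃ k : ℕ, k ≠ 0 ∧ ∀ i, (S ^ k *ᵥ 1) i < c ^ k := by
  have hc : 0 < c := ENNReal.ofReal_pos.1 (zero_le.trans_lt h)
  have hlim := spectrum.pow_nnnorm_pow_one_div_tendsto_nhds_spectralRadius
    (S.map (algebraMap ℝ ℂ))
  obtain ⟨k, hk, hk0⟩ :=
    ((hlim.eventually (gt_mem_nhds h)).and (Filter.eventually_ne_atTop 0)).exists
  refine ⟨k, hk0, fun i => ?_⟩
  have hk' : ‖S.map (algebraMap ℝ ℂ) ^ k‖ < c ^ k := by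
    have := ENNReal.rpow_lt_rpow hk (z := (k : ℝ)) (by positivity)
    rw [← ENNReal.rpow_mul, one_div_mul_cancel (by positivity), ENNReal.rpow_one,
      ENNReal.rpow_natCast, ← ENNReal.ofReal_pow hc.le] at this
    rw [← enorm_eq_nnnorm, ← ofReal_norm] at this
    exact (ENNReal.ofReal_lt_ofReal_iff (by positivity)).1 this
  have hreal : (S.map (algebraMap ℝ ℂ) ^ k *ᵥ 1) i = (((S ^ k *ᵥ 1) i : ℝ) : ℂ) := by
    have : S.map (algebraMap ℝ ℂ) ^ k = (S ^ k).map (algebraMap ℝ ℂ) :=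
      (map_pow (algebraMap ℝ ℂ).mapMatrix S k).symm
    rw [this]
    simp [mulVec, dotProduct]
  calc (S ^ k *ᵥ 1) i ≤ ‖(S.map (algebraMap ℝ ℂ) ^ k *ᵥ 1) i‖ := by
        rw [hreal, Complex.norm_real]; exact le_abs_self _
    _ ≤ ‖S.map (algebraMap ℝ ℂ) ^ k *ᵥ 1‖ := norm_le_pi_norm _ i
    _ ≤ ‖S.map (algebraMap ℝ ℂ) ^ k‖ * ‖(1 : Fin n → ℂ)‖ := linfty_opNorm_mulVec _ _
    _ ≤ ‖S.map (algebraMap ℝ ℂ) ^ k‖ * 1 := by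
        gcongr
        exact (pi_norm_le_iff_of_nonneg zero_le_one).2 fun j => by simp
    _ < c ^ k := by rwa [mul_one]

open Matrix in
/-- Above the spectral radius a nonnegative matrix has a strictly subinvariant positive vector. -/
theorem AOR.exists_pos_mulVec_lt {n : ℕ} {S : Matrix (Fin n) (Fin n) ℝ}
    (hS : ∀ i j, 0 ≤ S i j) {c : ℝ} (h : AOR.rho S < ENNReal.ofReal c) :
    ∃ z : Fin n → ℝ, (∀ i, 0 < z i) ∧ ∀ i, (S *ᵥ z) i < c * z i := by
  have hc : 0 < c := ENNReal.ofReal_pos.1 (zero_le.trans_lt h)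
  obtain ⟨k, hk0, hk⟩ := AOR.exists_pow_mulVec_one_lt h
  have hpow : ∀ m : ℕ, ∀ i, 0 ≤ (S ^ m *ᵥ 1) i := fun m => by
    induction m with
    | zero => simp
    | succ m ih => rw [pow_succ', ← mulVec_mulVec]; exact AOR.mulVec_nonneg hS ih
  -- The witness is a finite Neumann sum: `(c - S) ∑ c^j S^(k-1-j) = c^k - S^k`, which is positive
  -- on the all-ones vector. Its term `j = k - 1`, present as `k ≠ 0`, makes `z` positive.
  have hgeom := ((Commute.one_left S).smul_left c).mul_geom_sum₂ k
  have hz : ∀ i, ((∑ j ∈ Finset.range k, (c • (1 : Matrix (Fin n) (Fin n) ℝ)) ^ j *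
      S ^ (k - 1 - j)) *ᵥ 1) i = ∑ j ∈ Finset.range k, c ^ j * (S ^ (k - 1 - j) *ᵥ 1) i := by
    intro i
    simp [sum_mulVec, smul_pow, smul_mulVec]
  refine ⟨(∑ j ∈ Finset.range k, (c • (1 : Matrix (Fin n) (Fin n) ℝ)) ^ j *
    S ^ (k - 1 - j)) *ᵥ 1, fun i => ?_, fun i => ?_⟩
  · rw [hz]
    refine Finset.sum_pos' (fun j _ => _root_.mul_nonneg (by positivity) (hpow _ i))
      ⟨k - 1, Finset.mem_range.2 (by omega), ?_⟩
    simp only [Nat.sub_self, pow_zero, one_mulVec, Pi.one_apply, mul_one]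
    positivity
  · have h1 := congrFun (congrArg (· *ᵥ (1 : Fin n → ℝ)) hgeom) i
    simp only [← mulVec_mulVec, sub_mulVec, smul_pow, one_pow, smul_mulVec, one_mulVec,
      Pi.sub_apply, Pi.smul_apply, Pi.one_apply, smul_eq_mul, mul_one] at h1
    simp only [smul_pow, one_pow]
    linarith [hk i]

theorem AOR.rho_conj {n : ℕ} {M T : Matrix (Fin n) (Fin n) ℝ} (hM : IsUnit M) :
    AOR.rho (M * T * M⁻¹) = AOR.rho T := by
  have hdet := (Matrix.isUnit_iff_isUnit_det _).1 hM
  let f := (algebraMap ℝ ℂ).mapMatrix (m := Fin n)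
  let u : (Matrix (Fin n) (Fin n) ℂ)ˣ := ⟨f M, f M⁻¹,
    by rw [← map_mul, Matrix.mul_nonsing_inv _ hdet, map_one],
    by rw [← map_mul, Matrix.nonsing_inv_mul _ hdet, map_one]⟩
  have h : f (M * T * M⁻¹) = u * f T * (u⁻¹ : (Matrix (Fin n) (Fin n) ℂ)ˣ) := by
    rw [map_mul, map_mul]; rfl
  change spectralRadius ℂ (f (M * T * M⁻¹)) = spectralRadius ℂ (f T)
  rw [spectralRadius, spectralRadius, h, spectrum.units_conjugate]

/-! ### The AOR splitting -/

theorem AOR.L_nonneg {n : ℕ} {B : Matrix (Fin n) (Fin n) ℝ} (hB : AOR.IsZMatrix B)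
    (i j : Fin n) : 0 ≤ AOR.L B i j := by
  simp only [AOR.L, Matrix.of_apply]
  split_ifs with h
  · linarith [hB i j h.ne']
  · rfl

theorem AOR.U_nonneg {n : ℕ} {B : Matrix (Fin n) (Fin n) ℝ} (hB : AOR.IsZMatrix B)
    (i j : Fin n) : 0 ≤ AOR.U B i j := by
  simp only [AOR.U, Matrix.of_apply]
  split_ifs with h
  · linarith [hB i j h.ne]
  · rfl

/-- The subtrahend `N` of the splitting `B = (D - γ L) - N`. -/
noncomputable def AOR.splitN {n : ℕ} (γ : ℝ) (B : Matrix (Fin n) (Fin n) ℝ) :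
    Matrix (Fin n) (Fin n) ℝ :=
  (1 - γ) • AOR.L B + AOR.U B

theorem AOR.splitN_nonneg {n : ℕ} {γ : ℝ} (hγ₁ : γ ≤ 1) {B : Matrix (Fin n) (Fin n) ℝ}
    (hB : AOR.IsZMatrix B) (i j : Fin n) : 0 ≤ AOR.splitN γ B i j :=
  add_nonneg (_root_.mul_nonneg (sub_nonneg.2 hγ₁) (AOR.L_nonneg hB i j)) (AOR.U_nonneg hB i j)

theorem AOR.sub_splitN {n : ℕ} (γ : ℝ) (B : Matrix (Fin n) (Fin n) ℝ) :
    AOR.D B - γ • AOR.L B - AOR.splitN γ B = B := by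
  conv_rhs => rw [AOR.eq_D_sub_L_sub_U B]
  rw [AOR.splitN]
  module

-- Since `D - γ L = B + N` with `N ≥ 0`, the test vector `x` of `B` also serves for this Z-matrix.
open Matrix in
theorem AOR.isUnit_and_inv_nonneg_splitM {n : ℕ} {γ : ℝ} (hγ₀ : 0 ≤ γ) (hγ₁ : γ ≤ 1)
    {B : Matrix (Fin n) (Fin n) ℝ} (hB : AOR.IsZMatrix B) {x : Fin n → ℝ} (hx : ∀ i, 0 < x i)
    (hBx : ∀ i, 0 < (B *ᵥ x) i) :
    IsUnit (AOR.D B - γ • AOR.L B) ∧ ∀ i j, 0 ≤ (AOR.D B - γ • AOR.L B)⁻¹ i j := by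
  refine AOR.isUnit_and_inv_nonneg (fun i j hij => ?_) hx fun i => ?_
  · have h := _root_.mul_nonneg hγ₀ (AOR.L_nonneg hB i j)
    simpa [AOR.D, hij] using h
  · have h : AOR.D B - γ • AOR.L B = B + AOR.splitN γ B := by
      rw [← sub_eq_iff_eq_add, AOR.sub_splitN]
    rw [h, add_mulVec]
    exact add_pos_of_pos_of_nonneg (hBx i)
      (AOR.mulVec_nonneg (AOR.splitN_nonneg hγ₁ hB) (fun j => (hx j).le) i)

theorem AOR.iterMatrix_eq_one_sub {n : ℕ} {γ : ℝ} (ω : ℝ) {B : Matrix (Fin n) (Fin n) ℝ}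
    (hM : IsUnit (AOR.D B - γ • AOR.L B)) :
    AOR.iterMatrix γ ω B = 1 - ω • ((AOR.D B - γ • AOR.L B)⁻¹ * B) := by
  have h : (1 - ω) • AOR.D B + (ω - γ) • AOR.L B + ω • AOR.U B =
      (AOR.D B - γ • AOR.L B) - ω • B := by
    have e : ω • B = ω • (AOR.D B - AOR.L B - AOR.U B) := by rw [← AOR.eq_D_sub_L_sub_U B]
    rw [e]
    module
  rw [AOR.iterMatrix, h, mul_sub, Matrix.nonsing_inv_mul _ ((Matrix.isUnit_iff_isUnit_det _).1 hM),
    Matrix.mul_smul]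

/-- The matrix is the convex combination `(1 - ω) 1 + ω M⁻¹ N`. -/
theorem AOR.iterMatrix_nonneg {n : ℕ} {γ ω : ℝ} (hω₀ : 0 ≤ ω) (hω₁ : ω ≤ 1) (hγ₁ : γ ≤ 1)
    {B : Matrix (Fin n) (Fin n) ℝ} (hB : AOR.IsZMatrix B)
    (hM : IsUnit (AOR.D B - γ • AOR.L B))
    (hM' : ∀ i j, 0 ≤ (AOR.D B - γ • AOR.L B)⁻¹ i j) (i j : Fin n) :
    0 ≤ AOR.iterMatrix γ ω B i j := by
  have h : (AOR.D B - γ • AOR.L B)⁻¹ * B =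
      1 - (AOR.D B - γ • AOR.L B)⁻¹ * AOR.splitN γ B := by
    rw [← Matrix.nonsing_inv_mul _ ((Matrix.isUnit_iff_isUnit_det _).1 hM), ← mul_sub,
      AOR.sub_splitN]
  rw [AOR.iterMatrix_eq_one_sub ω hM, h]
  have h1 := AOR.mul_nonneg hM' (AOR.splitN_nonneg hγ₁ hB) i j
  have h2 : (0 : ℝ) ≤ (1 : Matrix (Fin n) (Fin n) ℝ) i j := by
    rw [Matrix.one_apply]; split_ifs <;> norm_num
  simp only [Matrix.sub_apply, Matrix.smul_apply, smul_eq_mul]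
  nlinarith [_root_.mul_nonneg hω₀ h1, _root_.mul_nonneg (sub_nonneg.2 hω₁) h2]

theorem AOR.splitM_apply {n : ℕ} (γ : ℝ) (B : Matrix (Fin n) (Fin n) ℝ) (i j : Fin n) :
    (AOR.D B - γ • AOR.L B) i j = (if i = j then 1 else if j < i then γ else 0) * B i j := by
  rcases lt_trichotomy i j with h | h | h
  · simp [AOR.D, AOR.L, h.ne, h.not_gt]
  · simp [AOR.D, AOR.L, h]
  · simp [AOR.D, AOR.L, h, h.ne']

/-- Preconditioning perturbs `D - γ L` by at most `Q' (D - γ L)`, where `Q' = -L Q` is the strictly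
lower triangular part of `Q`. -/
theorem AOR.splitM_precond_le {n : ℕ} {γ : ℝ} (hγ₀ : 0 ≤ γ) (hγ₁ : γ ≤ 1)
    {A Q : Matrix (Fin n) (Fin n) ℝ} (hA : AOR.IsZMatrix A) (hdiag : ∀ i, 0 ≤ A i i)
    (hQ : AOR.IsPrecondQ Q) (i j : Fin n) :
    (AOR.D ((1 + Q) * A) - γ • AOR.L ((1 + Q) * A) : Matrix (Fin n) (Fin n) ℝ) i j ≤
      ((1 - AOR.L Q) * (AOR.D A - γ • AOR.L A)) i j := by
  rw [AOR.splitM_apply, sub_mul, one_mul, Matrix.sub_apply, AOR.splitM_apply, add_mul, one_mul,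
    Matrix.add_apply, mul_add, sub_eq_add_neg]
  gcongr
  rw [Matrix.mul_apply, Matrix.mul_apply, Finset.mul_sum, ← Finset.sum_neg_distrib]
  -- The bound holds termwise. For `k = j` it uses `γ ≤ 1` and `A j j ≥ 0`. For `k ≠ j` the right
  -- side is nonzero only if `j < k < i`, where both weights are `γ`; otherwise the left side is
  -- nonpositive.
  refine Finset.sum_le_sum fun k _ => ?_
  rw [AOR.splitM_apply]
  simp only [AOR.L, Matrix.of_apply]
  rcases eq_or_ne i k with rfl | hik
  · simp [hQ.diag_eq_zero]
  have hq := hQ.offDiag_nonneg i k hik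
  rcases eq_or_ne k j with rfl | hkj
  · have hqa := _root_.mul_nonneg hq (hdiag k)
    rcases hik.lt_or_gt with h | h
    · simp [h.ne, h.not_gt]
    · simp only [h, h.ne', if_true, if_false]
      nlinarith
  · have hqa := mul_nonpos_of_nonneg_of_nonpos hq (hA k j hkj)
    have hγqa := mul_nonpos_of_nonneg_of_nonpos hγ₀ hqa
    rcases lt_trichotomy i j with h | h | h <;> rcases hik.lt_or_gt with h' | h' <;>
      rcases hkj.lt_or_gt with h'' | h'' <;>
      first
      | (exfalso; omega)
      | (simp only [h, h', h'', h'.not_gt, h''.not_gt, h.not_gt, h.ne, h.ne', hkj, if_true,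
          if_false]; linarith)
      | (subst h
         simp only [h', h'', h'.not_gt, h''.not_gt, hkj, if_true, if_false]; linarith)

/-- Multiply `R M - M' ≥ 0` by `M'⁻¹` on the left and `M⁻¹` on the right, then enlarge `R` to `P`.
-/
theorem AOR.inv_le_inv_mul {n : ℕ} {M M' P R : Matrix (Fin n) (Fin n) ℝ} (hM : IsUnit M)
    (hM0 : ∀ i j, 0 ≤ M⁻¹ i j) (hM' : IsUnit M') (hM'0 : ∀ i j, 0 ≤ M'⁻¹ i j)
    (h : ∀ i j, M' i j ≤ (R * M) i j) (hRP : ∀ i j, R i j ≤ P i j) (i j : Fin n) :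
    M⁻¹ i j ≤ (M'⁻¹ * P) i j := by
  have h1 := AOR.mul_nonneg (AOR.mul_nonneg hM'0 (C := R * M - M')
    fun i j => sub_nonneg.2 (h i j)) hM0 i j
  have h2 := AOR.mul_nonneg hM'0 (C := P - R) (fun i j => sub_nonneg.2 (hRP i j)) i j
  rw [mul_sub, Matrix.nonsing_inv_mul _ ((Matrix.isUnit_iff_isUnit_det _).1 hM'), sub_mul, one_mul,
    mul_assoc, mul_assoc, Matrix.mul_nonsing_inv _ ((Matrix.isUnit_iff_isUnit_det _).1 hM),
    mul_one] at h1
  rw [mul_sub] at h2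
  exact (sub_nonneg.1 h1).trans (sub_nonneg.1 h2)

/-! ### Convergence and comparison -/

-- `x` decreases strictly in every coordinate, by `ω M⁻¹ B x > 0`; finitely many coordinates give a
-- uniform factor `c < 1`.
open Matrix in
theorem AOR.rho_iterMatrix_lt_one {n : ℕ} {γ ω : ℝ} (hω₀ : 0 < ω) (hω₁ : ω ≤ 1)
    (hγ₁ : γ ≤ 1) {B : Matrix (Fin n) (Fin n) ℝ} (hB : AOR.IsZMatrix B)
    (hM : IsUnit (AOR.D B - γ • AOR.L B))
    (hM0 : ∀ i j, 0 ≤ (AOR.D B - γ • AOR.L B)⁻¹ i j)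
    {x : Fin n → ℝ} (hx : ∀ i, 0 < x i) (hBx : ∀ i, 0 < (B *ᵥ x) i) :
    AOR.rho (AOR.iterMatrix γ ω B) < 1 := by
  have hT0 := AOR.iterMatrix_nonneg hω₀.le hω₁ hγ₁ hB hM hM0
  have hlt : ∀ i, (AOR.iterMatrix γ ω B *ᵥ x) i < x i := fun i => by
    have := mul_pos hω₀ (AOR.mulVec_pos ((isUnit_nonsing_inv_iff).2 hM) hM0 hBx i)
    rw [AOR.iterMatrix_eq_one_sub ω hM, sub_mulVec, smul_mulVec, ← mulVec_mulVec, one_mulVec]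
    simpa using this
  obtain ⟨c, hc1, hc⟩ : ∃ c < 1, ∀ i, (AOR.iterMatrix γ ω B *ᵥ x) i ≤ c * x i := by
    rcases isEmpty_or_nonempty (Fin n) with h | h
    · exact ⟨0, zero_lt_one, fun i => h.elim i⟩
    · obtain ⟨k, -, hk⟩ := Finset.exists_max_image Finset.univ
        (fun j => (AOR.iterMatrix γ ω B *ᵥ x) j / x j) Finset.univ_nonempty
      exact ⟨_, (div_lt_one (hx k)).2 (hlt k),
        fun i => (div_le_iff₀ (hx i)).1 (hk i (Finset.mem_univ i))⟩
  exact (AOR.rho_le_of_mulVec_le hT0 hx hc).trans_lt (ENNReal.ofReal_lt_one.2 hc1)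

open Matrix in
/-- Comparison of two splittings: if `M⁻¹ ≤ C` entrywise, `1 - ω C A` and `1 - ω A M⁻¹` are
nonnegative, then `1 - ω C A` has at most the spectral radius of `1 - ω M⁻¹ A`, if the latter is
less than one. -/
theorem AOR.rho_le_rho_of_inv_le {n : ℕ} {ω : ℝ} (hω₀ : 0 < ω)
    {A M C : Matrix (Fin n) (Fin n) ℝ} (hM : IsUnit M) (hM0 : ∀ i j, 0 ≤ M⁻¹ i j)
    (hMC : ∀ i j, M⁻¹ i j ≤ C i j) (hS : ∀ i j, 0 ≤ (1 - ω • (A * M⁻¹)) i j)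
    (hT : ∀ i j, 0 ≤ (1 - ω • (C * A)) i j) (h1 : AOR.rho (1 - ω • (M⁻¹ * A)) < 1) :
    AOR.rho (1 - ω • (C * A)) ≤ AOR.rho (1 - ω • (M⁻¹ * A)) := by
  have hdet := (isUnit_iff_isUnit_det _).1 hM
  refine le_of_forall_gt_imp_ge_of_dense fun d hd => ?_
  obtain ⟨c, hc, hcd⟩ := exists_between (lt_min hd h1)
  lift c to NNReal using (hcd.trans_le (min_le_right _ _)).ne_top
  have hc1 : (c : ℝ) < 1 := by exact_mod_cast hcd.trans_le (min_le_right _ _)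
  refine le_trans ?_ (hcd.le.trans (min_le_left _ _))
  -- Passing to the conjugate `1 - ω A M⁻¹` is what yields `A x ≥ 0` for `x = M⁻¹ z`; a subinvariant
  -- vector of `1 - ω M⁻¹ A` would only control `M⁻¹ A x`.
  have hSconj : 1 - ω • (A * M⁻¹) = M * (1 - ω • (M⁻¹ * A)) * M⁻¹ := by
    rw [mul_sub, sub_mul, mul_one, mul_nonsing_inv _ hdet, Matrix.mul_smul, Matrix.smul_mul,
      ← mul_assoc M, mul_nonsing_inv _ hdet, one_mul]
  rw [← AOR.rho_conj hM, ← hSconj, ← ENNReal.ofReal_coe_nnreal] at hc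
  obtain ⟨z, hz, hSz⟩ := AOR.exists_pos_mulVec_lt hS hc
  have hx := AOR.mulVec_pos (isUnit_nonsing_inv_iff.2 hM) hM0 hz
  have hAx : ∀ i, (1 - c) * z i ≤ ω * (A *ᵥ (M⁻¹ *ᵥ z)) i := fun i => by
    have := (hSz i).le
    rw [sub_mulVec, smul_mulVec, ← mulVec_mulVec, one_mulVec] at this
    simp only [Pi.sub_apply, Pi.smul_apply, smul_eq_mul] at this
    linarith
  have hωAx : ∀ i, 0 ≤ ((ω • A) *ᵥ (M⁻¹ *ᵥ z) - (1 - (c : ℝ)) • z) i := fun i => by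
    simpa [smul_mulVec] using hAx i
  have hAx0 : ∀ i, 0 ≤ (A *ᵥ (M⁻¹ *ᵥ z)) i := fun i =>
    nonneg_of_mul_nonneg_right
      ((_root_.mul_nonneg (sub_nonneg.2 hc1.le) (hz i).le).trans (hAx i)) hω₀
  rw [← ENNReal.ofReal_coe_nnreal]
  refine AOR.rho_le_of_mulVec_le hT hx fun i => ?_
  -- Together, `ω C A x ≥ ω M⁻¹ A x ≥ (1 - c) M⁻¹ z = (1 - c) x`.
  have e1 := AOR.mulVec_nonneg (C := C - M⁻¹) (fun i j => sub_nonneg.2 (hMC i j)) hAx0 i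
  have e2 := AOR.mulVec_nonneg hM0 hωAx i
  rw [mulVec_sub, mulVec_smul, smul_mulVec, mulVec_smul] at e2
  rw [sub_mulVec] at e1
  rw [sub_mulVec, one_mulVec, smul_mulVec, ← mulVec_mulVec]
  simp only [Pi.sub_apply, Pi.smul_apply, smul_eq_mul] at e1 e2 ⊢
  nlinarith [_root_.mul_nonneg hω₀.le e1]

open Matrix in
theorem theorem3p2 {n : ℕ} (A Q : Matrix (Fin n) (Fin n) ℝ) (γ ω : ℝ)
    (hA : AOR.IsNonsingularMMatrix A)
    (hQ : AOR.IsPrecondQ Q)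
    (hPA : AOR.IsZMatrix ((1 + Q) * A))
    (hω₀ : 0 < ω) (hω₁ : ω ≤ 1) (hγ₀ : 0 ≤ γ) (hγ₁ : γ ≤ 1) :
    IsUnit (AOR.D A - γ • AOR.L A) ∧
    IsUnit (AOR.D ((1 + Q) * A) - γ • AOR.L ((1 + Q) * A)) ∧
    AOR.rho (AOR.iterMatrix γ ω ((1 + Q) * A)) ≤ AOR.rho (AOR.iterMatrix γ ω A) ∧
    AOR.rho (AOR.iterMatrix γ ω A) < 1 := by
  obtain ⟨hZ, hu, hinv, -⟩ := hA
  have hQ0 : ∀ i j, 0 ≤ Q i j := fun i j => by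
    rcases eq_or_ne i j with rfl | h
    · exact (hQ.diag_eq_zero i).ge
    · exact hQ.offDiag_nonneg i j h
  -- One test vector, `x = A⁻¹ 1`, serves both matrices: `A x = 1` and `P A x = 1 + Q 1`.
  have hx : ∀ i, 0 < (A⁻¹ *ᵥ 1) i :=
    AOR.mulVec_pos (isUnit_nonsing_inv_iff.2 hu) hinv (v := 1) fun _ => zero_lt_one
  have hAx : A *ᵥ (A⁻¹ *ᵥ 1) = 1 := by
    rw [mulVec_mulVec, mul_nonsing_inv _ ((isUnit_iff_isUnit_det _).1 hu), one_mulVec]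
  have hAx0 : ∀ i, 0 < (A *ᵥ (A⁻¹ *ᵥ 1)) i := fun i => by simp [hAx]
  have hPAx0 : ∀ i, 0 < (((1 + Q) * A) *ᵥ (A⁻¹ *ᵥ 1)) i := fun i => by
    rw [← mulVec_mulVec, hAx, add_mulVec, one_mulVec]
    exact add_pos_of_pos_of_nonneg zero_lt_one
      (AOR.mulVec_nonneg hQ0 (v := 1) (fun _ => zero_le_one) i)
  have hdiag : ∀ i, 0 ≤ A i i := fun i => by
    have h := hAx0 i
    rw [mulVec, dotProduct, ← Finset.add_sum_erase _ _ (Finset.mem_univ i)] at h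
    have h' : ∑ j ∈ Finset.univ.erase i, A i j * (A⁻¹ *ᵥ 1) j ≤ 0 :=
      Finset.sum_nonpos fun j hj => mul_nonpos_of_nonpos_of_nonneg
        (hZ i j (Finset.ne_of_mem_erase hj).symm) (hx j).le
    exact (pos_of_mul_pos_left (by linarith : 0 < A i i * (A⁻¹ *ᵥ 1) i) (hx i).le).le
  obtain ⟨hM, hM0⟩ := AOR.isUnit_and_inv_nonneg_splitM hγ₀ hγ₁ hZ hx hAx0
  obtain ⟨hM', hM'0⟩ := AOR.isUnit_and_inv_nonneg_splitM hγ₀ hγ₁ hPA hx hPAx0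
  have hlt := AOR.rho_iterMatrix_lt_one hω₀ hω₁ hγ₁ hZ hM hM0 hx hAx0
  refine ⟨hM, hM', ?_, hlt⟩
  have hT' := AOR.iterMatrix_nonneg hω₀.le hω₁ hγ₁ hPA hM' hM'0
  rw [AOR.iterMatrix_eq_one_sub ω hM] at hlt ⊢
  rw [AOR.iterMatrix_eq_one_sub ω hM', ← mul_assoc] at hT' ⊢
  refine AOR.rho_le_rho_of_inv_le hω₀ hM hM0 (AOR.inv_le_inv_mul hM hM0 hM' hM'0
    (AOR.splitM_precond_le hγ₀ hγ₁ hZ hdiag hQ) fun i j => ?_) (fun i j => ?_) hT' hlt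
  · rw [Matrix.sub_apply, Matrix.add_apply, sub_eq_add_neg]
    gcongr
    simp only [AOR.L, Matrix.of_apply]
    split_ifs
    · exact (neg_neg _).le
    · simpa using hQ0 i j
  · have h : A * (AOR.D A - γ • AOR.L A)⁻¹ =
        1 - AOR.splitN γ A * (AOR.D A - γ • AOR.L A)⁻¹ := by
      rw [← mul_nonsing_inv _ ((isUnit_iff_isUnit_det _).1 hM), ← sub_mul, AOR.sub_splitN]
    rw [h]
    have h1 := AOR.mul_nonneg (AOR.splitN_nonneg hγ₁ hZ) hM0 i j
    have h2 : (0 : ℝ) ≤ (1 : Matrix (Fin n) (Fin n) ℝ) i j := by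
      rw [one_apply]; split_ifs <;> norm_num
    simp only [Matrix.sub_apply, Matrix.smul_apply, smul_eq_mul]
    nlinarith [_root_.mul_nonneg hω₀.le h1, _root_.mul_nonneg (sub_nonneg.2 hω₁) h2]
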